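/- A $\beta$-normalized LCL $\mathcal P$ on oriented paths consists of the input labels $\{0,1\}$, a set $\Sigma_{\mathrm{out}}$ of $\beta$ output labels, a set $\mathcal C_{\mathrm{in-out}}\subseteq\{0,1\}\times\Sigma_{\mathrm{out}}$ and a set $\mathcal C_{\mathrm{out-out}}\subseteq\Sigma_{\mathrm{out}}\times\Sigma_{\mathrm{out}}$. An output labeling of an oriented path with input labels is correct if $(\mathrm{Input}(v),\mathrm{Output}(v))\in\mathcal C_{\mathrm{in-out}}$ for every node $v$, and $(\mathrm{Output}(v),\mathrm{Output}(u))\in\mathcal C_{\mathrm{out-out}}$ for every node $v$ that has a predecessor $u$. In the (deterministic) LOCAL model, the nodes of an $n$-node oriented path carry binary input labels and distinct identifiers from $\{1,\dots,n^k\}$, where $k\ge 1$ is a constant. An algorithm with running time $T(n)$ is a rule by which every node, knowing $n$, determines its output label from its radius-$T(n)$ neighborhood (topology, orientation, input labels and identifiers). It solves $\mathcal P$ if its output is correct on every such path, for every $n$. Theorem. There are constants $c>0$ and $\beta_0$ such that for every $\beta\ge\beta_0$ there is a $\beta$-normalized LCL $\mathcal P$ on oriented paths with the following two properties. 1. $\mathcal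 P$ can be solved in constant time: there is a number $t$ such that for every $k\ge1$ some algorithm solves $\mathcal P$ with running time $T(n)\le t$ for all $n$. 2. The time complexity of $\mathcal P$ is $2^{\Omega(\beta)}$: there is a number $N$ such that for every $k\ge 1$, every algorithm that solves $\mathcal P$ has running time $T(n)\ge 2^{c\beta}$ for all $n\ge N$. (The numbers $t$ and $N$ may depend on $\mathcal P$; the constant $c$ does not depend on $\beta$ or $\mathcal P$.) -/

import Mathlib

namespace PathLCL

/-- An instance on the globally oriented path with `n` nodes `0 → 1 → ⋯ → n - 1`
(the predecessor of node `i + 1` is node `i`): every node carries a binary input label and a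
globally unique identifier. -/
structure Instance (n : ℕ) where
  input : Fin n → Bool
  ident : Fin n → ℕ
  ident_injective : Function.Injective ident

/-- The identifiers come from the polynomially sized set `{1, …, n ^ k}`
(that is, they have `O(log n)` bits). -/
def Instance.IdentBounded {n : ℕ} (I : Instance n) (k : ℕ) : Prop :=
  ∀ v, 1 ≤ I.ident v ∧ I.ident v ≤ n ^ k

/-- What a node may see: the value at the signed offset `d` is the pair (input label, identifier)
of the node that lies `d` steps ahead along the orientation, or `none` if nothing is seen there. -/
abbrev View := ℤ → Option (Bool × ℕ)

/-- The radius-`t` neighbourhood of the node `v`: topology (with orientation), input labels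
and identifiers of all nodes at distance at most `t` from `v`. -/
def Instance.view {n : ℕ} (I : Instance n) (t : ℕ) (v : Fin n) : View := fun d =>
  if h : |d| ≤ (t : ℤ) ∧ 0 ≤ (v : ℤ) + d ∧ (v : ℤ) + d < (n : ℤ) then
    let u : Fin n := ⟨((v : ℤ) + d).toNat, by omega⟩
    some (I.input u, I.ident u)
  else none

/-- A deterministic algorithm in the LOCAL model on oriented paths with output labels `Fin β`.
On `n`-node paths it runs for `rounds n` rounds; every node, knowing `n`, maps its
radius-`rounds n` neighbourhood to its output label. -/
structure LocalAlgorithm (β : ℕ) where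
  rounds : ℕ → ℕ
  decide : ℕ → View → Fin β

/-- The global output of the algorithm on an instance. -/
def LocalAlgorithm.run {β n : ℕ} (A : LocalAlgorithm β) (I : Instance n) : Fin n → Fin β :=
  fun v => A.decide n (I.view (A.rounds n) v)

/-- A `β`-normalized LCL: binary inputs, `β` output labels, a set `inOut` of allowed pairs
(input of `v`, output of `v`), and a set `outOut` of allowed pairs
(output of `v`, output of the predecessor of `v`). -/
structure NormalizedLCL (β : ℕ) where
  inOut : Finset (Bool × Fin β)
  outOut : Finset (Fin β × Fin β)

/-- Correctness of a global output: the in–out constraint holds at every node, and the out–out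
constraint holds at every node that has a predecessor. -/
def NormalizedLCL.IsCorrect {β n : ℕ} (P : NormalizedLCL β) (input : Fin n → Bool)
    (output : Fin n → Fin β) : Prop :=
  (∀ v, (input v, output v) ∈ P.inOut) ∧
    ∀ u v : Fin n, (u : ℕ) + 1 = (v : ℕ) → (output v, output u) ∈ P.outOut

/-- The algorithm solves the problem on all oriented paths whose identifiers are taken
from `{1, …, n ^ k}`, where `n` is the number of nodes. -/
def LocalAlgorithm.Solves {β : ℕ} (A : LocalAlgorithm β) (P : NormalizedLCL β) (k : ℕ) : Prop :=
  ∀ (n : ℕ) (I : Instance n), I.IdentBounded k → P.IsCorrect I.input (A.run I)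

end PathLCL

/-! ### The labelling problem. -/

namespace PathLCL

/-! The input encodes a word over zero, one and hash. Every label carries the bit of its node and
claims the two preceding bits, so letters can be checked along edges. Hashes cut the word into
blocks, and a position has an offset from the last hash. The default output is an alternating
colouring, a global task. It may be interrupted only by a certificate: `gap` counts through a block
whose length is not `M`; `start` and `scan` verify a repetition, that is, two nonzero letters at the
same offset with only zeros strictly between them at that offset or above. A counter modulo `M` and
a flag telling whether a hash was passed in the current period suffice for this, so `O(M)` labels
are enough.

Constant time: a good stretch of length `M * 2 ^ j` contains a repetition or a nonzero letter at
offset at least `j` (`occ_in_window_or`). Offsets stay below `M`, so uncertified stretches are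
shorter than `M * 2 ^ M` (`exists_not_free`). Repetitions with no end of another one in their
interior are disjoint; they are scanned, and the colouring restarts after each certificate.

Lower bound: give block `i` a single one, at a height determined by the 2-adic valuation of `i + 1`.
Between two equal heights lies a greater one, so no repetition exists and the colours must alternate
over exponentially many blocks (`HardRun.alternates`). Inserting a still higher block in the middle
creates no repetition, but as `M` is odd it flips the relative parity of the two sides. Nodes on
either side that do not see the insertion answer as before, a contradiction (`two_pow_le_rounds`).
-/

/-- The letters read off the input bits. -/
inductive Letter
  | zero
  | one
  | hash

/-- The letter at a node, from the input bits of the node and of its two predecessors. -/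
def letterOf : Bool → Bool → Bool → Letter
  | _, true, true => .hash
  | false, true, false => .one
  | _, _, _ => .zero

/-- The output states: `color` is an alternating colouring, `start` and `scan` certify a
repetition in the word, and `gap` certifies that two consecutive hashes are not at distance `M`. -/
inductive State (M : ℕ)
  | color (c : Bool)
  | start
  | scan (r : Fin M) (f : Bool)
  | gap (r : Fin (M + 1))

instance (M : ℕ) : Nonempty (State M) := ⟨.start⟩

/-- An injective numbering of the states. -/
def State.code {M : ℕ} : State M → ℕ
  | .color c => c.toNat
  | .start => 2
  | .scan r f => 3 + 2 * r + f.toNat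
  | .gap r => 3 + 2 * M + r

lemma State.code_lt {M : ℕ} (q : State M) : q.code < 3 * M + 4 := by
  rcases q with (_ | _) | _ | ⟨r, (_ | _)⟩ | r <;> simp [State.code] <;> omega

lemma State.code_injective {M : ℕ} : Function.Injective (State.code (M := M)) := by
  rintro ((_ | _) | _ | ⟨r, (_ | _)⟩ | r) ((_ | _) | _ | ⟨s, (_ | _)⟩ | s) h <;>
    simp [State.code] at h ⊢ <;> omega

instance (M : ℕ) : Finite (State M) :=
  Finite.of_injective (fun q : State M => (⟨q.code, q.code_lt⟩ : Fin (3 * M + 4)))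
    fun _ _ h => State.code_injective (Fin.mk.inj h)

/-- The states in which a node may be right after a completed certificate. -/
def entry {M : ℕ} (σ : Letter) : State M → Prop
  | .color _ => True
  | .start => σ ≠ .zero
  | .scan _ _ => False
  | .gap r => (r : ℕ) = 0 ∧ σ = .hash

/-- The successors of a scanning state. -/
def scanStep {M : ℕ} (σ : Letter) (r : ℕ) (f : Bool) (q : State M) : Prop :=
  (∃ r' f', q = .scan r' f' ∧
    (((r' : ℕ) = r + 1 ∧ ((f = false ∧ f' = false ∧ σ = .zero) ∨
      (f = false ∧ f' = true ∧ σ = .hash) ∨ (f = true ∧ f' = true ∧ σ ≠ .hash))) ∨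
    (r + 1 = M ∧ f = true ∧ σ = .zero ∧ (r' : ℕ) = 0 ∧ f' = false))) ∨
  (r + 1 = M ∧ ((f = false ∧ σ = .hash) ∨ (f = true ∧ σ = .one)) ∧ entry σ q)

/-- The allowed pairs of states of consecutive nodes, if the second node has the letter `σ`. -/
def step {M : ℕ} (σ : Letter) : State M → State M → Prop
  | .color c, q => q = .color (!c) ∨ (entry σ q ∧ ∀ d, q ≠ .color d)
  | .start, q => scanStep σ 0 false q
  | .scan r f, q => scanStep σ r f q
  | .gap r, q => (σ ≠ .hash ∧ ∃ r', q = .gap r' ∧ (r' : ℕ) = min ((r : ℕ) + 1) M) ∨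
      (σ = .hash ∧ (r : ℕ) + 1 ≠ M ∧ entry σ q)

/-- The state of a scan started at offset `k` when it has reached the offset `o`. -/
def phase (M o k r : ℕ) (f : Bool) : Prop :=
  (r + k = o ∧ f = false) ∨ (o < k ∧ r + k = o + M ∧ f = true)

/-! ### Blocks, repetitions and the intended local labelling. -/

section Word

variable (w : ℤ → Letter) (M L : ℕ)

open Classical in
/-- The distance to the last hash, at most the first argument. -/
noncomputable def off : ℕ → ℤ → ℕ
  | 0, _ => 0
  | n + 1, x => if w x = .hash then 0 else off n (x - 1) + 1

/-- The position lies in a block of length exactly `M` between consecutive hashes. -/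
def good (x : ℤ) : Prop :=
  ∃ d < M + 1, 0 < d ∧ off w M x + d = M ∧ w (x + d) = .hash ∧
    ∀ e < M + 1, 0 < e → e < d → w (x + (e : ℕ)) ≠ .hash

/-- A repetition of length `l` starting at `x`. -/
def occ (x : ℤ) (l : ℕ) : Prop :=
  0 < l ∧ l ≤ L ∧ (∀ i < l, good w M (x + (i : ℕ))) ∧ off w M (x + l) = off w M x ∧
    w x ≠ .zero ∧ w (x + l) ≠ .zero ∧
    ∀ i < l, 0 < i → off w M x ≤ off w M (x + (i : ℕ)) → w (x + (i : ℕ)) = .zero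

/-- A repetition in whose interior no repetition ends. -/
def chosen (x : ℤ) (l : ℕ) : Prop :=
  occ w M L x l ∧ ∀ i < l, 0 < i → ∀ j < L + 1, ¬ occ w M L (x + ((i : ℤ) - (j : ℤ))) j

/-- The position is neither in a bad block nor in a chosen repetition. -/
def free (y : ℤ) : Prop :=
  good w M y ∧ ∀ i < L + 1, ∀ l < L + 1, i < l → ¬ chosen w M L (y - (i : ℕ)) l

open Classical in
/-- The parity of the distance to the last position that is not free. -/
noncomputable def parity : ℕ → ℤ → Bool
  | 0, _ => false
  | n + 1, x => if free w M L x then !(parity n (x - 1)) else false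

/-- The states a position may take in the local solution. -/
def Lab (y : ℤ) : State M → Prop
  | .color c => free w M L y ∧ c = parity w M L L y
  | .start => ∃ l < L + 1, chosen w M L y l
  | .scan r f => ∃ i < L + 1, ∃ l < L + 1, 0 < i ∧ i < l ∧ chosen w M L (y - (i : ℕ)) l ∧
      phase M (off w M y) (off w M (y - (i : ℕ))) r f
  | .gap r => ¬ good w M y ∧ (r : ℕ) = off w M y

end Word

/-! ### Offsets inside good and bad blocks. -/

section Offsets

variable {w : ℤ → Letter} {M L : ℕ}

lemma off_le (n : ℕ) (x : ℤ) : off w n x ≤ n := by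
  induction n generalizing x with
  | zero => simp [off]
  | succ n ih => simp only [off]; split_ifs <;> [omega; exact Nat.succ_le_succ (ih _)]

lemma off_min (n : ℕ) (x : ℤ) : off w n x = min (off w (n + 1) x) n := by
  induction n generalizing x with
  | zero => simp [off]
  | succ n ih =>
    rw [off, off]
    split_ifs
    · simp
    · rw [ih]; omega

lemma off_of_hash {x : ℤ} (h : w x = .hash) : off w M x = 0 := by
  cases M <;> simp [off, h]

lemma off_succ {x : ℤ} (h : w (x + 1) ≠ .hash) :
    off w M (x + 1) = min (off w M x + 1) M := by
  rw [off_min, off, if_neg h]; simp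

lemma good.off_lt {x : ℤ} (h : good w M x) : off w M x < M := by
  obtain ⟨d, -, h1, h2, -⟩ := h; omega

lemma good.next {x : ℤ} (h : good w M x) (hx : w (x + 1) ≠ .hash) :
    good w M (x + 1) ∧ off w M (x + 1) = off w M x + 1 := by
  obtain ⟨d, hd, h1, h2, h3, h4⟩ := h
  have hd1 : d ≠ 1 := by rintro rfl; exact hx (by simpa using h3)
  have ho : off w M (x + 1) = off w M x + 1 := by rw [off_succ hx]; omega
  refine ⟨⟨d - 1, by omega, by omega, by omega, ?_, fun e he e0 ed => ?_⟩, ho⟩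
  · rw [← h3]; congr 1; omega
  · have := h4 (e + 1) (by omega) (by omega) (by omega)
    rwa [show x + 1 + (e : ℤ) = x + ((e + 1 : ℕ) : ℤ) by push_cast; ring]

lemma good.off_of_next_hash {x : ℤ} (h : good w M x) (hx : w (x + 1) = .hash) :
    off w M x + 1 = M := by
  obtain ⟨d, hd, h1, h2, h3, h4⟩ := h
  have hd1 : ¬ 1 < d := fun hd1 => h4 1 (by omega) one_pos hd1 (by simpa using hx)
  omega

lemma off_ne_of_not_good {x : ℤ} (h : ¬ good w M x) (hx : w (x + 1) = .hash) :
    off w M x + 1 ≠ M := fun ho =>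
  h ⟨1, by omega, one_pos, ho, by simpa using hx, fun e _ _ _ => by omega⟩

lemma good.prev {x : ℤ} (h : good w M (x + 1)) (hx : w (x + 1) ≠ .hash) : good w M x := by
  obtain ⟨d, hd, h1, h2, h3, h4⟩ := h
  have ho := off_succ (M := M) hx
  refine ⟨d + 1, by omega, by omega, by omega, ?_, fun e he e0 ed => ?_⟩
  · rw [← h3]; congr 1; push_cast; ring
  · obtain rfl | he1 := eq_or_ne e 1
    · simpa using hx
    · have := h4 (e - 1) (by omega) (by omega) (by omega)
      rwa [show x + 1 + ((e - 1 : ℕ) : ℤ) = x + (e : ℤ) by omega] at this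

end Offsets

/-! ### Repetitions are frequent and can be chosen disjointly. -/

section Repetitions

variable {w : ℤ → Letter} {M L : ℕ}

lemma chosen.disjoint {x x' : ℤ} {l l' : ℕ} (h : chosen w M L x l) (h' : chosen w M L x' l')
    (hl : x + l < x' + l') : x + l ≤ x' := by
  by_contra! hx
  refine h'.2 (x + l - x').toNat (by omega) (by omega) l (by have := h.1.2.1; omega) ?_
  rw [show x' + (((x + l - x').toNat : ℤ) - (l : ℤ)) = x by omega]
  exact h.1

/-- A later start with the same end would be a nonzero letter at the forbidden offset inside the
longer repetition. Hence the end determines the start. -/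
lemma occ.start_le {x x' : ℤ} {l l' : ℕ} (h : occ w M L x l) (h' : occ w M L x' l')
    (hl : x + l = x' + l') : x' ≤ x := by
  by_contra! hx
  have e : x + ((x' - x).toNat : ℤ) = x' := by omega
  have := h.2.2.2.2.2.2 (x' - x).toNat (by have := h'.1; omega) (by omega)
  rw [e, ← h'.2.2.2.1, ← hl, h.2.2.2.1] at this
  exact h'.2.2.2.2.1 (this le_rfl)

lemma chosen.eq_of_mem {x x' y : ℤ} {l l' : ℕ} (h : chosen w M L x l)
    (h' : chosen w M L x' l') (h1 : x ≤ y) (h2 : y < x + l) (h3 : x' ≤ y) (h4 : y < x' + l') :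
    x = x' ∧ l = l' := by
  have e : x + l = x' + l' := by
    rcases lt_trichotomy (x + l) (x' + l') with hl | hl | hl
    · have := h.disjoint h' hl; omega
    · exact hl
    · have := h'.disjoint h hl; omega
  have := h.1.start_le h'.1 e
  have := h'.1.start_le h.1 e.symm
  omega

lemma chosen.good {x y : ℤ} {l : ℕ} (h : chosen w M L x l) (h1 : x ≤ y) (h2 : y < x + l) :
    good w M y := by
  have := h.1.2.2.1 (y - x).toNat (by omega)
  rwa [show x + ((y - x).toNat : ℤ) = y by omega] at this

lemma free.not_chosen {x y : ℤ} {l : ℕ} (hf : free w M L y) (h : chosen w M L x l) (h1 : x ≤ y)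
    (h2 : y < x + l) : False := by
  have hl := h.1.2.1
  refine hf.2 (y - x).toNat (by omega) l (by omega) (by omega) ?_
  rwa [show y - ((y - x).toNat : ℤ) = x by omega]

lemma hash_in_window (hM : 0 < M) {x : ℤ} (h : ∀ i < M, good w M (x + (i : ℕ))) :
    ∃ i < M, w (x + (i : ℕ)) = .hash := by
  by_contra! hn
  have key : ∀ i < M, i + 1 ≤ off w M (x + (i : ℕ)) := by
    intro i
    induction i with
    | zero =>
      intro hi
      have := hn 0 hi
      have h1 : w (x - 1 + 1) ≠ .hash := by simpa using this
      have := off_succ (M := M) h1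
      simp at this ⊢
      omega
    | succ i ih =>
      intro hi
      have hi' := ih (by omega)
      have e : x + ((i + 1 : ℕ) : ℤ) = x + (i : ℕ) + 1 := by push_cast; ring
      have h1 := hn (i + 1) hi
      rw [e] at h1 ⊢
      have := off_succ (M := M) h1
      omega
  have := key (M - 1) (by omega)
  have := (h (M - 1) (by omega)).off_lt
  omega

/-- Doubling argument: both halves contain a nonzero letter at offset at least `j`. If no offset
exceeds `j`, two successive such letters have offset exactly `j` and form a repetition. -/
lemma occ_in_window_or (hM : 0 < M) (j : ℕ) (hL : M * 2 ^ j ≤ L) (x : ℤ)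
    (h : ∀ i < M * 2 ^ j, good w M (x + (i : ℕ))) :
    (∃ i l : ℕ, i + l < M * 2 ^ j ∧ occ w M L (x + (i : ℕ)) l) ∨
      ∃ i < M * 2 ^ j, w (x + (i : ℕ)) ≠ .zero ∧ j ≤ off w M (x + (i : ℕ)) := by
  induction j generalizing x with
  | zero =>
    right
    obtain ⟨i, hi, h1⟩ := hash_in_window hM (by simpa using h)
    exact ⟨i, by simpa using hi, by simp [h1], Nat.zero_le _⟩
  | succ j ih =>
    have e : M * 2 ^ (j + 1) = M * 2 ^ j + M * 2 ^ j := by ring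
    rw [e] at h hL ⊢
    set D := M * 2 ^ j
    rcases ih (by omega) x (fun i hi => h i (by omega)) with ⟨i, l, hil, ho⟩ | ⟨a, ha, ha1, ha2⟩
    · exact .inl ⟨i, l, by omega, ho⟩
    rcases ih (by omega) (x + D) (fun i hi => by
      have := h (D + i) (by omega)
      rwa [Nat.cast_add, ← add_assoc] at this) with ⟨i, l, hil, ho⟩ | ⟨b, hb, hb1, hb2⟩
    · exact .inl ⟨D + i, l, by omega, by rwa [Nat.cast_add, ← add_assoc]⟩
    by_contra! hn
    obtain ⟨hn1, hn2⟩ := hn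
    rw [add_assoc, ← Nat.cast_add] at hb1 hb2
    have hoff : ∀ i < D + D, w (x + (i : ℕ)) ≠ .zero → off w M (x + (i : ℕ)) ≤ j := fun i hi h0 =>
      Nat.lt_succ_iff.mp (hn2 i hi h0)
    -- The repetition ends at the next nonzero letter after `a` of offset at least `j`; the letter
    -- `b` of the second half shows that there is one.
    have hex : ∃ l : ℕ, 0 < l ∧ w (x + ((a + l : ℕ) : ℤ)) ≠ .zero ∧
        j ≤ off w M (x + ((a + l : ℕ) : ℤ)) :=
      ⟨D + b - a, by omega, by rwa [show a + (D + b - a) = D + b by omega],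
        by rwa [show a + (D + b - a) = D + b by omega]⟩
    classical
    have hle : Nat.find hex ≤ D + b - a := Nat.find_min' hex
      ⟨by omega, by rwa [show a + (D + b - a) = D + b by omega],
        by rwa [show a + (D + b - a) = D + b by omega]⟩
    obtain ⟨s1, s2, s3⟩ := Nat.find_spec hex
    have hmin := fun i => @Nat.find_min _ _ hex i
    set l := Nat.find hex
    have ea := hoff a (by omega) ha1
    have el := hoff (a + l) (by omega) s2
    have ec : ∀ i : ℕ, x + (a : ℕ) + (i : ℤ) = x + ((a + i : ℕ) : ℤ) := fun i => by
      push_cast; ring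
    refine hn1 a l (by omega) ⟨s1, by omega, fun i hi => ?_, ?_, ha1, ?_, fun i hi h0 hle => ?_⟩
    · rw [ec]; exact h _ (by omega)
    · rw [ec]; omega
    · rwa [ec]
    · rw [ec] at hle ⊢
      by_contra hz
      exact hmin i hi ⟨h0, hz, by omega⟩

/-- If two repetitions crossed, the start of one would lie inside the other and the end of the other
inside the first, so each offset would be smaller than the other. -/
lemma occ.not_crossing {x : ℤ} {l t j : ℕ} (h : occ w M L x l)
    (h' : occ w M L (x + ((t : ℤ) - (j : ℤ))) j) (ht : 0 < t) (htl : t < l) (htj : t < j) :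
    False := by
  have e1 : x + ((t : ℤ) - (j : ℤ)) + (j : ℕ) = x + (t : ℕ) := by ring
  have e2 : x + ((t : ℤ) - (j : ℤ)) + ((j - t : ℕ) : ℤ) = x := by omega
  obtain ⟨-, -, -, h4, h5, -, h7⟩ := h
  obtain ⟨-, -, -, k4, -, k6, k7⟩ := h'
  rw [e1] at k4 k6
  have a := k7 (j - t) (by omega) (by omega)
  rw [e2] at a
  have b := h7 t htl ht
  have a' : ¬ _ := fun hh => h5 (a hh)
  have b' : ¬ _ := fun hh => k6 (b hh)
  omega

lemma exists_not_free (hM : 0 < M) (y : ℤ) :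
    ∃ i < M * 2 ^ M, ¬ free w M (M * 2 ^ M) (y - (i : ℕ)) := by
  by_contra! hf
  set L := M * 2 ^ M with hL
  have hLpos : 0 < L := by positivity
  set x : ℤ := y - ((L - 1 : ℕ) : ℤ) with hx
  have hf' : ∀ i < L, free w M L (x + (i : ℕ)) := fun i hi => by
    have := hf (L - 1 - i) (by omega)
    rwa [show y - ((L - 1 - i : ℕ) : ℤ) = x + (i : ℕ) by omega] at this
  have hocc : ∃ e, ∃ i l : ℕ, i + l = e ∧ e < L ∧ occ w M L (x + (i : ℕ)) l := by
    rcases occ_in_window_or hM M le_rfl x (fun i hi => (hf' i hi).1) with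
      ⟨i, l, h1, h2⟩ | ⟨i, h1, -, h3⟩
    · exact ⟨_, i, l, rfl, h1, h2⟩
    · have := (hf' i h1).1.off_lt; omega
  classical
  -- The repetition with the earliest end is chosen: one ending in its interior either lies in the
  -- window and ends earlier, or starts before the window and crosses it.
  obtain ⟨i, l, hil, he, ho⟩ := Nat.find_spec hocc
  have hmin := fun e => @Nat.find_min _ _ hocc e
  rw [← hil] at hmin he
  refine (hf' i (by omega)).not_chosen (x := x + (i : ℕ)) (l := l) ⟨ho, ?_⟩ le_rfl
    (by have := ho.1; omega)
  intro t ht t0 j hj hoj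
  by_cases hji : j ≤ i + t
  · refine hmin (i + t) (by omega) ⟨i + t - j, j, by omega, by omega, ?_⟩
    rwa [show x + ((i + t - j : ℕ) : ℤ) = x + (i : ℕ) + ((t : ℤ) - (j : ℤ)) by omega]
  · exact ho.not_crossing hoj t0 ht (by omega)

lemma parity_stable {n : ℕ} {x : ℤ} (h : ∃ i < n, ¬ free w M L (x - (i : ℕ))) :
    parity w M L (n + 1) x = parity w M L n x := by
  induction n generalizing x with
  | zero => obtain ⟨i, hi, -⟩ := h; omega
  | succ n ih =>
    by_cases hf : free w M L x
    · rw [parity, if_pos hf, ih, parity, if_pos hf]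
      obtain ⟨i, hi, h⟩ := h
      have : i ≠ 0 := by rintro rfl; simp [hf] at h
      exact ⟨i - 1, by omega, by rwa [show x - 1 - ((i - 1 : ℕ) : ℤ) = x - (i : ℕ) by omega]⟩
    · rw [parity, if_neg hf, parity, if_neg hf]

end Repetitions

/-! ### The intended labelling satisfies the constraints. -/

section LocalSolution

variable {w : ℤ → Letter} {M L : ℕ}

lemma Lab.entry {y : ℤ} {q : State M} (h : Lab w M L (y + 1) q)
    (hy : good w M y ∨ w (y + 1) = .hash) (hq : ∀ r f, q ≠ .scan r f) : entry (w (y + 1)) q := by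
  match q, h with
  | .color c, h => trivial
  | .start, ⟨l, _, hl⟩ => exact hl.1.2.2.2.2.1
  | .scan r f, _ => exact hq r f rfl
  | .gap r, ⟨h1, h2⟩ =>
    have hh : w (y + 1) = .hash := by
      rcases hy with hy | hy
      · by_contra hn
        exact h1 (hy.next hn).1
      · exact hy
    exact ⟨by rw [h2, off_of_hash hh], hh⟩

lemma Lab.scan_covers {y : ℤ} {r : Fin M} {f : Bool} (h : Lab w M L (y + 1) (.scan r f)) :
    ∃ x l, chosen w M L x l ∧ x ≤ y ∧ y + 1 < x + l ∧ phase M (off w M (y + 1)) (off w M x) r f := by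
  obtain ⟨i, hi, l, hl, h0, hil, hc, hp⟩ := h
  exact ⟨_, l, hc, by omega, by omega, hp⟩

lemma scanStep_of_chosen (hM : 1 < M) {x y : ℤ} {l r : ℕ} {f : Bool} (hc : chosen w M L x l)
    (h1 : x ≤ y) (h2 : y < x + l) (hp : phase M (off w M y) (off w M x) r f) {q : State M}
    (hq : Lab w M L (y + 1) q) : scanStep (w (y + 1)) r f q := by
  have hgy := hc.good h1 h2
  have hk := (hc.good le_rfl (by have := hc.1.1; omega)).off_lt
  rcases eq_or_lt_of_le (show y + 1 ≤ x + l by omega) with he | hlt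
  · right
    have ho := hc.1.2.2.2.1
    have hz := hc.1.2.2.2.2.2.1
    rw [← he] at ho hz
    have hent : entry (w (y + 1)) q := hq.entry (.inl hgy) fun r f hqs => by
      subst hqs
      obtain ⟨x', l', hc', a, b, -⟩ := hq.scan_covers
      have := hc.eq_of_mem hc' h1 h2 a (by omega)
      omega
    by_cases hh : w (y + 1) = .hash
    · have h0 := off_of_hash (M := M) hh
      have := hgy.off_of_next_hash hh
      have hf : r + 1 = M ∧ f = false := by
        rcases hp with ⟨a, b⟩ | ⟨a, b, c⟩
        · exact ⟨by omega, b⟩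
        · omega
      exact ⟨hf.1, .inl ⟨hf.2, hh⟩, hent⟩
    · have hn := (hgy.next hh).2
      have h1' : w (y + 1) = .one := by
        cases hw : w (y + 1) <;> simp_all
      have hf : r + 1 = M ∧ f = true := by
        rcases hp with ⟨a, b⟩ | ⟨a, b, c⟩
        · omega
        · exact ⟨by omega, c⟩
      exact ⟨hf.1, .inr ⟨hf.2, h1'⟩, hent⟩
  · left
    have hg1 := hc.good (y := y + 1) (by omega) hlt
    match q, hq with
    | .color c, hq => exact (hq.1.not_chosen hc (by omega) hlt).elim
    | .gap r, hq => exact (hq.1 hg1).elim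
    | .start, ⟨l', _, hl'⟩ =>
      have := hc.eq_of_mem hl' (y := y + 1) (by omega) hlt le_rfl (by have := hl'.1.1; omega)
      omega
    | .scan r' f', hq =>
      obtain ⟨x', l', hc', a, b, hp'⟩ := hq.scan_covers
      obtain ⟨rfl, rfl⟩ := hc.eq_of_mem hc' h1 h2 a (by omega)
      refine ⟨r', f', rfl, ?_⟩
      have hz := hc.1.2.2.2.2.2.2 (y + 1 - x).toNat (by omega) (by omega)
      rw [show x + ((y + 1 - x).toNat : ℤ) = y + 1 by omega] at hz
      have hr' := r'.2
      by_cases hh : w (y + 1) = .hash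
      · left
        have h0 := off_of_hash (M := M) hh
        have h3 := hgy.off_of_next_hash hh
        -- A scan started at a hash has to end at the next hash, so a hash in the interior means a
        -- positive starting offset.
        have hx0 : off w M x ≠ 0 := fun h => by
          have := hz (by omega)
          rw [hh] at this; cases this
        rcases hp with ⟨a1, b1⟩ | ⟨a1, b1, c1⟩
        · rcases hp' with ⟨a2, b2⟩ | ⟨a2, b2, c2⟩
          · omega
          · exact ⟨by omega, .inr (.inl ⟨b1, c2, hh⟩)⟩
        · omega
      · have hn := (hgy.next hh).2
        rcases hp with ⟨a1, b1⟩ | ⟨a1, b1, c1⟩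
        · have hz' := hz (by omega)
          rcases hp' with ⟨a2, b2⟩ | ⟨a2, b2, c2⟩
          · exact .inl ⟨by omega, .inl ⟨b1, b2, hz'⟩⟩
          · omega
        · rcases hp' with ⟨a2, b2⟩ | ⟨a2, b2, c2⟩
          · exact .inr ⟨by omega, c1, hz (by omega), by omega, b2⟩
          · exact .inl ⟨by omega, .inr (.inr ⟨c1, c2, hh⟩)⟩

lemma exists_lab (y : ℤ) : ∃ q, Lab w M L y q := by
  by_cases hg : good w M y
  · by_cases hf : free w M L y
    · exact ⟨.color _, hf, rfl⟩
    · simp only [free, hg, true_and, not_forall, not_not] at hf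
      obtain ⟨i, hi, l, hl, hil, hc⟩ := hf
      rcases Nat.eq_zero_or_pos i with rfl | h0
      · exact ⟨.start, l, hl, by simpa using hc⟩
      · have hk := (hc.good le_rfl (by omega)).off_lt
        have ho := hg.off_lt
        by_cases hle : off w M (y - (i : ℕ)) ≤ off w M y
        · exact ⟨.scan ⟨off w M y - off w M (y - (i : ℕ)), by omega⟩ false, i, hi, l, hl, h0, hil,
            hc, .inl ⟨by simp; omega, rfl⟩⟩
        · exact ⟨.scan ⟨off w M y + M - off w M (y - (i : ℕ)), by omega⟩ true, i, hi, l, hl, h0,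
            hil, hc, .inr ⟨by omega, by simp; omega, rfl⟩⟩
  · exact ⟨.gap ⟨off w M y, Nat.lt_succ_iff.mpr (off_le _ _)⟩, hg, rfl⟩

lemma Lab.step (hM : 1 < M) (hL : L = M * 2 ^ M) {y : ℤ} {q q' : State M} (h : Lab w M L y q)
    (h' : Lab w M L (y + 1) q') : step (w (y + 1)) q q' := by
  match q, h with
  | .color c, ⟨hf, hc⟩ =>
    by_cases hq : ∃ d, q' = .color d
    · obtain ⟨d, rfl⟩ := hq
      left
      obtain ⟨hf', rfl⟩ := h'
      have hLpos : 0 < L := by rw [hL]; positivity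
      obtain ⟨i, hi, hn⟩ := exists_not_free (w := w) (M := M) (by omega) (y + 1)
      rw [← hL] at hi hn
      -- The cutoff `L` of `parity` is harmless since a non-free position occurs within `L` steps;
      -- one extra unit of depth exposes the alternation.
      rw [← parity_stable ⟨i, hi, hn⟩, hc, parity, if_pos hf', add_sub_cancel_right]
    · push Not at hq
      refine .inr ⟨h'.entry (.inl hf.1) fun r f hs => ?_, hq⟩
      subst hs
      obtain ⟨x, l, hx, a, b, -⟩ := h'.scan_covers
      exact hf.not_chosen hx a (by omega)
  | .start, ⟨l, _, hl⟩ =>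
    exact scanStep_of_chosen hM hl le_rfl (by have := hl.1.1; omega) (.inl ⟨by simp, rfl⟩) h'
  | .scan r f, ⟨i, _, l, _, h0, hil, hc, hp⟩ =>
    exact scanStep_of_chosen hM hc (by omega) (by omega) hp h'
  | .gap r, ⟨hg, hr⟩ =>
    by_cases hh : w (y + 1) = .hash
    · refine .inr ⟨hh, by rw [hr]; exact off_ne_of_not_good hg hh, h'.entry (.inr hh) ?_⟩
      rintro r f rfl
      obtain ⟨x, l, hx, a, b, -⟩ := h'.scan_covers
      exact hg (hx.good a (by omega))
    · have hg' : ¬ good w M (y + 1) := fun hn => hg (hn.prev hh)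
      refine .inl ⟨hh, ?_⟩
      match q', h' with
      | .color _, h' => exact (hg' h'.1.1).elim
      | .start, ⟨l, _, hl⟩ => exact (hg' (hl.good le_rfl (by have := hl.1.1; omega))).elim
      | .scan r f, h' =>
        obtain ⟨x, l, hx, a, b, -⟩ := h'.scan_covers
        exact (hg (hx.good a (by omega))).elim
      | .gap r', h' => exact ⟨r', rfl, by rw [h'.2, off_succ hh, hr]⟩

end LocalSolution

/-! ### The intended labelling is computed within a constant radius. -/

section Locality

/-- The value at a position depends only on the stream within a fixed distance. -/
def IsLocal {α γ : Type*} (F : (ℤ → α) → ℤ → γ) : Prop :=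
  ∃ R : ℕ, ∀ w w' x x', (∀ d : ℤ, |d| ≤ R → w (x + d) = w' (x' + d)) → F w x = F w' x'

variable {α γ δ ε : Type*}

lemma IsLocal.const (c : γ) : IsLocal fun (_ : ℤ → α) _ => c := ⟨0, fun _ _ _ _ _ => rfl⟩

lemma IsLocal.eval : IsLocal fun (w : ℤ → α) x => w x :=
  ⟨0, fun w w' x x' h => by simpa using h 0 (by simp)⟩

lemma IsLocal.shift {F : (ℤ → α) → ℤ → γ} (h : IsLocal F) (c : ℤ) :
    IsLocal fun w x => F w (x + c) := by
  obtain ⟨R, h⟩ := h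
  refine ⟨R + c.natAbs, fun w w' x x' hw => h _ _ _ _ fun d hd => ?_⟩
  rw [add_assoc, add_assoc]
  exact hw _ ((abs_add_le c d).trans (by push_cast; rw [add_comm]; gcongr))

lemma IsLocal.map {F : (ℤ → α) → ℤ → γ} (h : IsLocal F) (g : γ → δ) :
    IsLocal fun w x => g (F w x) := by
  obtain ⟨R, h⟩ := h
  exact ⟨R, fun w w' x x' hw => congrArg g (h w w' x x' hw)⟩

lemma IsLocal.map₂ {F : (ℤ → α) → ℤ → γ} {G : (ℤ → α) → ℤ → δ} (hF : IsLocal F)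
    (hG : IsLocal G) (g : γ → δ → ε) : IsLocal fun w x => g (F w x) (G w x) := by
  obtain ⟨R, hF⟩ := hF
  obtain ⟨S, hG⟩ := hG
  refine ⟨R + S, fun w w' x x' hw => ?_⟩
  exact congrArg₂ g (hF w w' x x' fun d hd => hw d (by push_cast; omega))
    (hG w w' x x' fun d hd => hw d (by push_cast; omega))

lemma IsLocal.pi {ι : Type*} [Finite ι] {F : ι → (ℤ → α) → ℤ → γ} (h : ∀ i, IsLocal (F i)) :
    IsLocal fun w x i => F i w x := by
  choose R h using h
  obtain ⟨S, hS⟩ := (Set.finite_range R).bddAbove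
  exact ⟨S, fun w w' x x' hw => funext fun i => h i w w' x x' fun d hd => hw d
    (hd.trans (by exact_mod_cast hS ⟨i, rfl⟩))⟩

lemma IsLocal.not {P : (ℤ → α) → ℤ → Prop} (h : IsLocal P) : IsLocal fun w x => ¬ P w x :=
  h.map Not

lemma IsLocal.and {P Q : (ℤ → α) → ℤ → Prop} (hP : IsLocal P) (hQ : IsLocal Q) :
    IsLocal fun w x => P w x ∧ Q w x := hP.map₂ hQ And

lemma IsLocal.imp {P Q : (ℤ → α) → ℤ → Prop} (hP : IsLocal P) (hQ : IsLocal Q) :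
    IsLocal fun w x => P w x → Q w x := hP.map₂ hQ fun p q => p → q

lemma IsLocal.forall_lt {P : ℕ → (ℤ → α) → ℤ → Prop} (h : ∀ i, IsLocal (P i)) (n : ℕ) :
    IsLocal fun w x => ∀ i < n, P i w x := by
  have := (IsLocal.pi fun i : Fin n => h i).map fun p => ∀ i, p i
  simpa [Fin.forall_iff] using this

lemma IsLocal.exists_lt {P : ℕ → (ℤ → α) → ℤ → Prop} (h : ∀ i, IsLocal (P i)) (n : ℕ) :
    IsLocal fun w x => ∃ i < n, P i w x := by
  have := (IsLocal.pi fun i : Fin n => h i).map fun p => ∃ i, p i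
  simpa [Fin.exists_iff] using this

lemma IsLocal.comp {F : (ℤ → γ) → ℤ → δ} {G : (ℤ → α) → ℤ → γ} (hF : IsLocal F)
    (hG : IsLocal G) : IsLocal fun w x => F (G w) x := by
  obtain ⟨R, hF⟩ := hF
  obtain ⟨S, hG⟩ := hG
  refine ⟨R + S, fun w w' x x' hw => hF _ _ _ _ fun d hd => hG _ _ _ _ fun e he => ?_⟩
  rw [add_assoc, add_assoc]
  exact hw _ (by push_cast; rw [abs_le] at *; omega)

variable (M L : ℕ)

lemma isLocal_off (n : ℕ) : IsLocal fun w x => off w n x := by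
  classical
  induction n with
  | zero => exact .const 0
  | succ n ih =>
    exact (IsLocal.eval.map₂ (ih.shift (-1)) fun (a : Letter) (b : ℕ) =>
      if a = .hash then 0 else b + 1)

lemma isLocal_good : IsLocal fun w x => good w M x := by
  refine .exists_lt (fun d => .and (.const _) (.and ?_ (.and ?_ ?_))) _
  · exact (isLocal_off M).map fun o => o + d = M
  · exact (IsLocal.eval.shift d).map fun a => a = Letter.hash
  · exact .forall_lt (fun e => .imp (.const _) (.imp (.const _)
      ((IsLocal.eval.shift e).map fun a => a ≠ Letter.hash))) _

lemma isLocal_occ (l : ℕ) : IsLocal fun w x => occ w M L x l := by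
  have ho := isLocal_off M
  refine .and (.const _) (.and (.const _) (.and ?_ (.and ?_ (.and ?_ (.and ?_ ?_)))))
  · exact .forall_lt (fun i => (isLocal_good M).shift i) _
  · exact (ho.shift l).map₂ ho Eq
  · exact IsLocal.eval.map fun a => a ≠ Letter.zero
  · exact (IsLocal.eval.shift l).map fun a => a ≠ Letter.zero
  · exact .forall_lt (fun i => .imp (.const _) (.imp (ho.map₂ (ho.shift i) fun a b => a ≤ b)
      ((IsLocal.eval.shift i).map fun a => a = Letter.zero))) _

lemma isLocal_chosen (l : ℕ) : IsLocal fun w x => chosen w M L x l :=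
  (isLocal_occ M L l).and <| .forall_lt (fun i => .imp (.const _) <| .forall_lt
    (fun j => ((isLocal_occ M L j).shift ((i : ℤ) - (j : ℤ))).not) _) _

lemma isLocal_free : IsLocal fun w x => free w M L x :=
  (isLocal_good M).and <| .forall_lt (fun i => .forall_lt (fun l => .imp (.const _)
    ((isLocal_chosen M L l).shift (-(i : ℤ))).not) _) _

lemma isLocal_parity (n : ℕ) : IsLocal fun w x => parity w M L n x := by
  classical
  induction n with
  | zero => exact .const _
  | succ n ih =>
    exact ((isLocal_free M L).map₂ (ih.shift (-1)) fun p (b : Bool) =>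
      if p then !b else false)

lemma isLocal_lab (q : State M) : IsLocal fun w x => Lab w M L x q := by
  have ho := isLocal_off M
  match q with
  | .color c => exact (isLocal_free M L).and ((isLocal_parity M L L).map fun b => c = b)
  | .start => exact .exists_lt (fun l => (isLocal_chosen M L l)) _
  | .scan r f =>
    exact .exists_lt (fun i => .exists_lt (fun l => .and (.const _) <| .and (.const _) <|
      ((isLocal_chosen M L l).shift (-(i : ℤ))).and
        (ho.map₂ (ho.shift (-(i : ℤ))) fun a b => phase M a b r f)) _) _
  | .gap r => exact (isLocal_good M).not.and (ho.map fun a => (r : ℕ) = a)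

/-- The word of letters of a stream of bits. -/
def word (b : ℤ → Bool) (x : ℤ) : Letter := letterOf (b (x - 2)) (b (x - 1)) (b x)

/-- A local solution. -/
noncomputable def solution (b : ℤ → Bool) (x : ℤ) : State M :=
  Classical.epsilon (Lab (word b) M (M * 2 ^ M) x)

lemma isLocal_solution : IsLocal (solution M) := by
  -- The whole predicate on states is local, as there are finitely many states; so its `epsilon` is
  -- a consistent local choice.
  have h1 : IsLocal fun w x => Lab w M (M * 2 ^ M) x := .pi fun q => isLocal_lab M _ q
  have h2 : IsLocal word := by
    have e := IsLocal.eval (α := Bool)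
    exact ((e.shift (-2)).map₂ (e.shift (-1)) Prod.mk).map₂ e fun p c => letterOf p.1 p.2 c
  exact (h1.comp h2).map Classical.epsilon

variable {M}

lemma step_solution (hM : 1 < M) (b : ℤ → Bool) (x : ℤ) :
    step (word b (x + 1)) (solution M b x) (solution M b (x + 1)) :=
  Lab.step hM rfl (Classical.epsilon_spec (exists_lab x)) (Classical.epsilon_spec (exists_lab _))

end Locality

/-! ### The encoded problem and its constant-time algorithm. -/

/-- The full labels: the bits of a node and its two predecessors, and a state. -/
abbrev Label (M : ℕ) := (Bool × Bool × Bool) × State M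

/-- The numbering of the labels. -/
def Label.code {M : ℕ} (l : Label M) : ℕ :=
  8 * l.2.code + 4 * l.1.1.toNat + 2 * l.1.2.1.toNat + l.1.2.2.toNat

lemma Label.code_lt {M : ℕ} (l : Label M) : Label.code l < 24 * M + 32 := by
  obtain ⟨⟨a, b, c⟩, q⟩ := l
  have := q.code_lt
  have := a.toNat_le
  have := b.toNat_le
  have := c.toNat_le
  simp only [Label.code]; omega

lemma Label.code_injective {M : ℕ} : Function.Injective (Label.code (M := M)) := by
  rintro ⟨⟨a, b, c⟩, q⟩ ⟨⟨a', b', c'⟩, q'⟩ h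
  have h4 : q.code = q'.code := by
    revert h; cases a <;> cases b <;> cases c <;> cases a' <;> cases b' <;> cases c' <;>
      simp [Label.code] <;> omega
  obtain rfl := State.code_injective h4
  revert h
  cases a <;> cases b <;> cases c <;> cases a' <;> cases b' <;> cases c' <;>
      simp [Label.code] <;> omega

open Classical in
/-- The problem whose labels are embedded into `Fin β`. -/
noncomputable def problem {M β : ℕ} (e : Label M ↪ Fin β) : NormalizedLCL β where
  inOut := Finset.univ.filter fun p => ∃ l, e l = p.2 ∧ l.1.2.2 = p.1
  outOut := Finset.univ.filter fun p => ∃ l l', e l' = p.1 ∧ e l = p.2 ∧ l'.1.1 = l.1.2.1 ∧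
    l'.1.2.1 = l.1.2.2 ∧ step (letterOf l'.1.1 l'.1.2.1 l'.1.2.2) l.2 l'.2

/-- The input bits in a view, extended by `false`. -/
def View.bits (V : View) (d : ℤ) : Bool := ((V d).map Prod.fst).getD false

theorem exists_constant_algorithm {M β : ℕ} (hM : 1 < M) (e : Label M ↪ Fin β) :
    ∃ t : ℕ, ∀ k : ℕ, ∃ A : LocalAlgorithm β, A.Solves (problem e) k ∧ ∀ n, A.rounds n ≤ t := by
  have hloc : IsLocal fun b x => e ((b (x - 2), b (x - 1), b x), solution M b x) := by
    have h := IsLocal.eval (α := Bool)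
    exact (((h.shift (-2)).map₂ ((h.shift (-1)).map₂ h Prod.mk) Prod.mk).map₂
      (isLocal_solution M) Prod.mk).map e
  obtain ⟨R, hR⟩ := hloc
  refine ⟨R, fun k => ⟨⟨fun _ => R, fun _ V =>
    e ((V.bits (0 - 2), V.bits (0 - 1), V.bits 0), solution M V.bits 0)⟩, ?_, fun _ => le_rfl⟩⟩
  intro n I _
  -- Padding with `false` agrees with `View.bits`, so the path ends need no special treatment.
  let b : ℤ → Bool := fun x => if h : 0 ≤ x ∧ x < n then I.input ⟨x.toNat, by omega⟩ else false
  have hb : ∀ v : Fin n, b v = I.input v := fun v => by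
    have : 0 ≤ (v : ℤ) ∧ (v : ℤ) < n := by omega
    simp [b]
  have hview : ∀ (v : Fin n) (d : ℤ), |d| ≤ R → (I.view R v).bits d = b (v + d) := by
    intro v d hd
    by_cases h : 0 ≤ (v : ℤ) + d ∧ (v : ℤ) + d < n
    · simp only [View.bits, Instance.view, b, hd, h, and_self, dif_pos]; rfl
    · have : ¬ (|d| ≤ (R : ℤ) ∧ 0 ≤ (v : ℤ) + d ∧ (v : ℤ) + d < n) := fun h' => h h'.2
      simp only [View.bits, Instance.view, b, dif_neg h, dif_neg this]; rfl
  have hrun : ∀ v : Fin n, LocalAlgorithm.run ⟨fun _ => R, fun _ V =>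
      e ((V.bits (0 - 2), V.bits (0 - 1), V.bits 0), solution M V.bits 0)⟩ I v =
      e ((b (v - 2), b (v - 1), b v), solution M b v) := fun v =>
    hR _ _ 0 v fun d hd => by rw [zero_add, hview v d hd]
  constructor
  · intro v
    rw [hrun]
    simp only [problem, Finset.mem_filter, Finset.mem_univ, true_and]
    exact ⟨_, rfl, hb v⟩
  · intro u v huv
    rw [hrun, hrun]
    simp only [problem, Finset.mem_filter, Finset.mem_univ, true_and]
    have hv : (v : ℤ) = u + 1 := by omega
    refine ⟨_, _, rfl, rfl, ?_, ?_, ?_⟩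
    · simp only [hv]; congr 1; ring
    · simp only [hv]; congr 1; ring
    · simp only [hv]; exact step_solution hM b u

/-! ### Invariants of arbitrary scans. -/

section Scans

variable {M : ℕ}

/-- The state `q` is scanning, with counter `r` and flag `f`. -/
def Scans (q : State M) (r : ℕ) (f : Bool) : Prop :=
  (q = .start ∧ r = 0 ∧ f = false) ∨ ∃ r' : Fin M, q = .scan r' f ∧ (r' : ℕ) = r

lemma Scans.scanStep {q q' : State M} {r : ℕ} {f : Bool} {σ : Letter} (h : Scans q r f)
    (hs : step σ q q') : scanStep σ r f q' := by
  rcases h with ⟨rfl, rfl, rfl⟩ | ⟨r', rfl, rfl⟩ <;> exact hs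

lemma Scans.lt (hM : 0 < M) {q : State M} {r : ℕ} {f : Bool} (h : Scans q r f) : r < M := by
  rcases h with ⟨-, rfl, -⟩ | ⟨r', -, rfl⟩
  exacts [hM, r'.2]

/-- The number of steps on zeros by which a scan has advanced. -/
def ScanAge (q : State M) (v : ℕ) : Prop :=
  ∃ r f, Scans q r f ∧ v = if f then r else M + r

lemma ScanAge.lt (hM : 0 < M) {q : State M} {v : ℕ} (h : ScanAge q v) : v < 2 * M := by
  obtain ⟨r, f, h, rfl⟩ := h
  have := h.lt hM
  split_ifs <;> omega

lemma ScanAge.succ {q q' : State M} {v : ℕ} (h : ScanAge q v) (hs : step .zero q q') :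
    ScanAge q' (v + 1) := by
  obtain ⟨r, f, h, rfl⟩ := h
  rcases h.scanStep hs with ⟨r', f', rfl, h⟩ | ⟨-, ⟨-, h⟩ | ⟨-, h⟩, -⟩
  · refine ⟨r', f', .inr ⟨r', rfl, rfl⟩, ?_⟩
    rcases h with ⟨a, ⟨rfl, rfl, -⟩ | ⟨-, -, h⟩ | ⟨rfl, rfl, -⟩⟩ | ⟨a, rfl, -, b, rfl⟩
    · simp; omega
    · cases h
    · simp; omega
    · simp; omega
  · cases h
  · cases h

/-- No scan can begin on a zero, so a scan seen after a zero was already running. -/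
lemma ScanAge.prev {q q' : State M} {v : ℕ} (h : ScanAge q' v) (hs : step .zero q q') :
    ∃ u, ScanAge q u := by
  have hent : ¬ entry .zero q' := by
    obtain ⟨r, f, ⟨rfl, -, -⟩ | ⟨r', rfl, -⟩, -⟩ := h <;> simp [entry]
  match q, hs with
  | .color c, hs =>
    rcases hs with rfl | hs
    · obtain ⟨r, f, ⟨h, -, -⟩ | ⟨r', h, -⟩, -⟩ := h <;> cases h
    · exact (hent hs.1).elim
  | .start, _ => exact ⟨_, 0, false, .inl ⟨rfl, rfl, rfl⟩, rfl⟩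
  | .scan r f, _ => exact ⟨_, r, f, .inr ⟨r, rfl, rfl⟩, rfl⟩
  | .gap r, hs =>
    rcases hs with ⟨-, r', rfl, -⟩ | ⟨h, -⟩
    · obtain ⟨r, f, ⟨h, -, -⟩ | ⟨r', h, -⟩, -⟩ := h <;> cases h
    · cases h

/-- The state is that of a scan from offset `k` that has reached offset `o`. -/
def ScanPhase (o k : ℕ) (q : State M) : Prop := ∃ r f, Scans q r f ∧ phase M o k r f

lemma ScanPhase.zero {o k : ℕ} {q q' : State M} (h : ScanPhase o k q)
    (hs : step .zero q q') : ScanPhase (o + 1) k q' := by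
  obtain ⟨r, f, h, hp⟩ := h
  rcases h.scanStep hs with ⟨r', f', rfl, h⟩ | ⟨-, ⟨-, h⟩ | ⟨-, h⟩, -⟩
  · refine ⟨r', f', .inr ⟨r', rfl, rfl⟩, ?_⟩
    have hr := r'.2
    rcases h with ⟨a, ⟨rfl, rfl, -⟩ | ⟨-, -, h⟩ | ⟨rfl, rfl, -⟩⟩ | ⟨a, rfl, -, b, rfl⟩
    · simp [phase] at hp ⊢; omega
    · cases h
    · simp [phase] at hp ⊢; omega
    · simp [phase] at hp ⊢; omega
  · cases h
  · cases h

lemma ScanPhase.one {o k : ℕ} {q q' : State M} (h : ScanPhase o k q) (ho : o + 1 < k)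
    (hs : step .one q q') : ScanPhase (o + 1) k q' := by
  obtain ⟨r, f, h, hp⟩ := h
  rcases h.scanStep hs with ⟨r', f', rfl, h⟩ | ⟨a, ⟨-, h⟩ | ⟨rfl, -⟩, -⟩
  · refine ⟨r', f', .inr ⟨r', rfl, rfl⟩, ?_⟩
    rcases h with ⟨a, ⟨-, -, h⟩ | ⟨-, -, h⟩ | ⟨rfl, rfl, -⟩⟩ | ⟨-, -, h, -⟩
    · cases h
    · cases h
    · simp [phase] at hp ⊢; omega
    · cases h
  · cases h
  · simp [phase] at hp; omega

lemma ScanPhase.not_one {o k : ℕ} {q q' : State M} (h : ScanPhase o k q) (ho : k < o + 1)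
    (hs : step .one q q') : False := by
  obtain ⟨r, f, h, hp⟩ := h
  have hf : f = false := by
    rcases hp with ⟨-, h⟩ | ⟨h, -⟩
    · exact h
    · omega
  subst hf
  rcases h.scanStep hs with ⟨r', f', rfl, h⟩ | ⟨-, ⟨-, h⟩ | ⟨h, -⟩, -⟩
  · rcases h with ⟨-, ⟨-, -, h⟩ | ⟨-, -, h⟩ | ⟨h, -⟩⟩ | ⟨-, -, h, -⟩ <;> cases h
  · cases h
  · cases h

lemma ScanPhase.hash {o k : ℕ} {q q' : State M} (h : ScanPhase o k q) (ho : o + 1 = M)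
    (hk : 0 < k) (hkM : k < M) (hs : step .hash q q') : ScanPhase 0 k q' := by
  obtain ⟨r, f, h, hp⟩ := h
  have hf : f = false ∧ r + k = o := by
    rcases hp with ⟨h, h'⟩ | ⟨h, -⟩
    · exact ⟨h', h⟩
    · omega
  obtain ⟨rfl, hr⟩ := hf
  rcases h.scanStep hs with ⟨r', f', rfl, h⟩ | ⟨a, -⟩
  · refine ⟨r', f', .inr ⟨r', rfl, rfl⟩, ?_⟩
    rcases h with ⟨a, ⟨-, -, h⟩ | ⟨-, rfl, -⟩ | ⟨h, -⟩⟩ | ⟨-, h, -⟩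
    · cases h
    · exact .inr ⟨hk, by omega, rfl⟩
    · cases h
    · cases h
  · omega

end Scans

/-! ### On a hard word every certificate fails. -/

/-- A word with `B` blocks of length `M` from position `s` on, surrounded by zeros, in which the
block `i` has a single `one`, at offset `h i`, and a run of the problem on it. -/
structure HardRun (M B s : ℕ) (h : ℕ → ℕ) (w : ℕ → Letter) (q : ℕ → State M) : Prop where
  step : ∀ p, s ≤ p + 2 * M + 1 → p < s + B * M + 2 * M → step (w (p + 1)) (q p) (q (p + 1))
  pos : 2 * M < s
  before : ∀ p, s ≤ p + 2 * M → p < s → w p = .zero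
  after : ∀ p, s + B * M < p → p ≤ s + B * M + 2 * M → w p = .zero
  hash : ∀ i ≤ B, w (s + i * M) = .hash
  height_pos : ∀ i < B, 0 < h i
  height_lt : ∀ i < B, h i < M
  one : ∀ i < B, w (s + i * M + h i) = .one
  zero : ∀ i < B, ∀ o, 0 < o → o < M → o ≠ h i → w (s + i * M + o) = .zero
  higher : ∀ j < B, ∀ i < j, h i = h j → ∃ l, i < l ∧ l < j ∧ h i < h l

namespace HardRun

variable {M B s : ℕ} {h : ℕ → ℕ} {w : ℕ → Letter} {q : ℕ → State M}

lemma step_in (H : HardRun M B s h w q) {i o : ℕ} (hi : i < B) (ho : o < M) :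
    PathLCL.step (w (s + i * M + (o + 1))) (q (s + i * M + o)) (q (s + i * M + (o + 1))) := by
  have : (i + 1) * M ≤ B * M := Nat.mul_le_mul_right M hi
  rw [add_mul, one_mul] at this
  exact H.step (s + i * M + o) (by have := H.pos; omega) (by omega)

/-- Each zero raises the age of a scan by one, and ages stay below `2 * M`; this is why zero margins
of that length are used. -/
lemma no_long_zeros (hM : 0 < M) {p v : ℕ} (hv : ScanAge (q p) v)
    (hs : ∀ j < 2 * M, PathLCL.step .zero (q (p + j)) (q (p + (j + 1)))) : False := by
  have key : ∀ j ≤ 2 * M, ScanAge (q (p + j)) (v + j) := by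
    intro j
    induction j with
    | zero => exact fun _ => hv
    | succ j ih => exact fun hj => (ih (by omega)).succ (hs j (by omega))
  have := (key _ le_rfl).lt hM
  omega

lemma not_scan_before (H : HardRun M B s h w q) (hM : 0 < M) {v : ℕ} :
    ¬ ScanAge (q (s - 1)) v := by
  intro hv
  have hpos := H.pos
  have hs : ∀ j < 2 * M, PathLCL.step .zero (q (s - 1 - 2 * M + j))
      (q (s - 1 - 2 * M + (j + 1))) := fun j hj => by
    have := H.step (s - 1 - 2 * M + j) (by omega) (by omega)
    rwa [H.before (s - 1 - 2 * M + j + 1) (by omega) (by omega)] at this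
  have key : ∀ j ≤ 2 * M, ∃ u, ScanAge (q (s - 1 - 2 * M + (2 * M - j))) u := by
    intro j
    induction j with
    | zero => exact fun _ => ⟨v, by rwa [show s - 1 - 2 * M + (2 * M - 0) = s - 1 by omega]⟩
    | succ j ih =>
      intro hj
      obtain ⟨u, hu⟩ := ih (by omega)
      have := hs (2 * M - (j + 1)) (by omega)
      rw [show 2 * M - (j + 1) + 1 = 2 * M - j by omega] at this
      exact hu.prev this
  obtain ⟨u, hu⟩ := key _ le_rfl
  rw [Nat.sub_self, add_zero] at hu
  exact no_long_zeros hM hu hs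

/-- The zeros in front exclude a scan already under way, and a gap certificate must be over at the
hash. -/
lemma entry_first (H : HardRun M B s h w q) (hM : 0 < M) : entry .hash (q s) := by
  have hpos := H.pos
  have hs := H.step (s - 1) (by omega) (by omega)
  have h0 := H.hash 0 (Nat.zero_le _)
  simp only [zero_mul, add_zero] at h0
  rw [show s - 1 + 1 = s by omega, h0] at hs
  have hn := fun v => H.not_scan_before hM (v := v)
  revert hs hn
  generalize q (s - 1) = q0
  intro hs hn
  match q0, hs with
  | .color c, hs =>
    rcases hs with hs | hs
    · rw [hs]; trivial
    · exact hs.1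
  | .start, _ => exact (hn _ ⟨0, false, .inl ⟨rfl, rfl, rfl⟩, rfl⟩).elim
  | .scan r f, _ => exact (hn _ ⟨r, f, .inr ⟨r, rfl, rfl⟩, rfl⟩).elim
  | .gap r, hs =>
    rcases hs with ⟨h, -⟩ | ⟨-, -, h⟩
    · exact (h rfl).elim
    · exact h

/-- The disjunction `hh` says that the one of the block is not met, or is met below offset `k`,
where the flag is set and ones are tolerated. -/
lemma run_block (H : HardRun M B s h w q) {j o k : ℕ} (hj : j < B)
    (hp : ScanPhase o k (q (s + j * M + o))) (d : ℕ) (hd : o + d < M)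
    (hh : o + d < h j ∨ h j ≤ o ∨ h j < k) : ScanPhase (o + d) k (q (s + j * M + (o + d))) := by
  induction d with
  | zero => exact hp
  | succ d ih =>
    have ih := ih (by omega) (by omega)
    have hs := H.step_in hj (o := o + d) (by omega)
    by_cases ho : o + d + 1 = h j
    · rw [ho, H.one j hj] at hs
      rw [← ho] at hs
      exact ih.one (by omega) hs
    · rw [H.zero j hj _ (by omega) (by omega) ho] at hs
      exact ih.zero hs

lemma next_block (H : HardRun M B s h w q) {j o k : ℕ} (hj : j < B) (hk : k < M) (hk0 : 0 < k)
    (ho : o < M) (hp : ScanPhase o k (q (s + j * M + o))) (hh : h j ≤ o ∨ h j < k) :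
    ScanPhase 0 k (q (s + (j + 1) * M)) := by
  have h1 := H.run_block hj hp (M - 1 - o) (by omega) (by omega)
  rw [show o + (M - 1 - o) = M - 1 by omega] at h1
  have hs := H.step_in hj (o := M - 1) (by omega)
  rw [show s + j * M + (M - 1 + 1) = s + (j + 1) * M by rw [add_mul]; omega,
    H.hash _ (by omega)] at hs
  exact h1.hash (by omega) hk0 hk hs

/-- Blocks lower than `k` are passed, and a block of height `k` never comes before a higher one,
which blocks the scan. If neither comes, the final zeros outlast it. -/
lemma not_scanPhase (H : HardRun M B s h w q) {k : ℕ} (hk : k < M) (d : ℕ) :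
    ∀ j, j + d = B → ScanPhase 0 k (q (s + j * M)) →
      (∀ l, j ≤ l → l < B → h l = k → ∃ l', j ≤ l' ∧ l' < l ∧ k < h l') → False := by
  induction d with
  | zero =>
    rintro j rfl ⟨r, f, hp, -⟩ -
    refine no_long_zeros (by omega) ⟨r, f, hp, rfl⟩ fun i hi => ?_
    have := H.step (s + j * M + i) (by have := H.pos; omega) (by simp; omega)
    rwa [H.after (s + j * M + i + 1) (by simp) (by simp; omega)] at this
  | succ d ih =>
    intro j hj hp hl
    rcases lt_trichotomy (h j) k with hlt | heq | hgt
    · refine ih (j + 1) (by omega) (H.next_block (by omega) hk (by omega) (by omega) hp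
        (.inr hlt)) fun l hjl hlB hlk => ?_
      obtain ⟨l', a, b, c⟩ := hl l (by omega) hlB hlk
      have : l' ≠ j := by rintro rfl; omega
      exact ⟨l', by omega, b, c⟩
    · obtain ⟨l', a, b, -⟩ := hl j le_rfl (by omega) heq
      omega
    · have h1 := H.run_block (by omega) hp (h j - 1)
        (by have := H.height_lt j (by omega); omega) (by omega)
      have hs := H.step_in (i := j) (by omega) (o := 0 + (h j - 1))
        (by have := H.height_lt j (by omega); omega)
      rw [show 0 + (h j - 1) + 1 = h j by omega, H.one j (by omega)] at hs
      exact h1.not_one (by omega) hs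

lemma not_gap (H : HardRun M B s h w q) (hM : 0 < M) {i : ℕ} (hi : i < B) {r : Fin (M + 1)}
    (hr : (r : ℕ) = 0) (hq : q (s + i * M) = .gap r) : False := by
  have key : ∀ o < M, ∃ r : Fin (M + 1), (r : ℕ) = o ∧ q (s + i * M + o) = .gap r := by
    intro o
    induction o with
    | zero => exact fun _ => ⟨r, hr, hq⟩
    | succ o ih =>
      intro ho
      obtain ⟨r, rfl, hr⟩ := ih (by omega)
      have hs := H.step_in hi (o := r) (by omega)
      have hw : w (s + i * M + (r + 1)) ≠ .hash := by
        by_cases hh : (r : ℕ) + 1 = h i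
        · rw [hh, H.one i hi]; simp
        · rw [H.zero i hi _ (by omega) ho hh]; simp
      rw [hr] at hs
      rcases hs with ⟨-, r', h1, h2⟩ | ⟨h1, -⟩
      · exact ⟨r', by omega, h1⟩
      · exact (hw h1).elim
  obtain ⟨r, hr, hq⟩ := key (M - 1) (by omega)
  have hs := H.step_in hi (o := M - 1) (by omega)
  rw [show s + i * M + (M - 1 + 1) = s + (i + 1) * M by rw [add_mul]; omega,
    H.hash _ (by omega), hq] at hs
  rcases hs with ⟨h1, -⟩ | ⟨-, h1, -⟩
  · exact h1 rfl
  · omega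

lemma color_of_entry (H : HardRun M B s h w q) (hM : 0 < M) {d : ℕ} (hd : d < B * M)
    (he : entry (w (s + d)) (q (s + d))) : ∃ c, q (s + d) = .color c := by
  obtain ⟨i, o, ho, rfl⟩ : ∃ i o, o < M ∧ d = i * M + o :=
    ⟨d / M, d % M, Nat.mod_lt _ hM, by rw [mul_comm]; exact (Nat.div_add_mod d M).symm⟩
  have hi : i < B := by
    by_contra! hn
    have := Nat.mul_le_mul_right M hn
    omega
  rw [← add_assoc] at he ⊢
  rcases hq : q (s + i * M + o) with c | _ | ⟨r, f⟩ | r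
  · exact ⟨c, rfl⟩
  · rw [hq] at he
    exfalso
    have hsc : Scans (q (s + i * M + o)) 0 false := .inl ⟨hq, rfl, rfl⟩
    rcases Nat.eq_zero_or_pos o with rfl | ho0
    · refine H.not_scanPhase hM (B - i) i (by omega) ⟨0, false, hsc, .inl ⟨rfl, rfl⟩⟩
        fun l _ hl hl0 => ?_
      have := H.height_pos l hl
      omega
    · have hoh : o = h i := by
        by_contra hn
        exact he (H.zero i hi o ho0 ho hn)
      subst hoh
      -- A scan started on the one of block `i` has offset `h i`; `higher` puts a greater height
      -- before the next equal one.
      refine H.not_scanPhase ho (B - (i + 1)) (i + 1) (by omega)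
        (H.next_block hi ho ho0 ho ⟨0, false, hsc, .inl ⟨by omega, rfl⟩⟩ (.inl le_rfl))
        fun l hil hl hl0 => ?_
      obtain ⟨l', a, b, c⟩ := H.higher l hl i (by omega) hl0.symm
      exact ⟨l', a, b, c⟩
  · rw [hq] at he; exact he.elim
  · rw [hq] at he
    exfalso
    rcases Nat.eq_zero_or_pos o with rfl | ho0
    · exact H.not_gap hM hi he.1 hq
    · have := he.2
      by_cases hh : o = h i
      · rw [hh, H.one i hi] at this; cases this
      · rw [H.zero i hi o ho0 ho hh] at this; cases this

/-- Leaving the colouring needs an entry state that is not a colour, which `color_of_entry`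
excludes. -/
theorem alternates (H : HardRun M B s h w q) (hM : 0 < M) :
    ∃ c, ∀ d < B * M, q (s + d) = .color (xor c d.bodd) := by
  rcases Nat.eq_zero_or_pos (B * M) with h0 | h0
  · exact ⟨false, fun d hd => by omega⟩
  have hh := H.hash 0 (Nat.zero_le _)
  rw [zero_mul] at hh
  obtain ⟨c, hc⟩ := H.color_of_entry hM h0 (by rw [hh]; exact H.entry_first hM)
  refine ⟨c, fun d => ?_⟩
  induction d with
  | zero => intro _; simpa using hc
  | succ d ih =>
    intro hd
    have hs := H.step (s + d) (by omega) (by omega)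
    rw [ih (by omega)] at hs
    rcases hs with hs | ⟨he, hs⟩
    · rw [← add_assoc, hs, Nat.bodd_succ]; simp
    · obtain ⟨c', hc'⟩ := H.color_of_entry hM hd he
      exact (hs c' hc').elim

end HardRun

/-! ### Input bits that realise a hard word. -/

section HardWord

variable {M B : ℕ} {h : ℕ → ℕ}

/-- The input bits of a hard word. -/
def hardBit (M B : ℕ) (h : ℕ → ℕ) (p : ℕ) : Bool :=
  decide ((3 ≤ p / M ∧ p / M ≤ 3 + B ∧ p % M ≤ 1) ∨
    (3 ≤ p / M ∧ p / M < 3 + B ∧ p % M = h (p / M - 3)))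

lemma hardBit_iff {j o : ℕ} (ho : o < M) : hardBit M B h (j * M + o) = true ↔
    (3 ≤ j ∧ j ≤ 3 + B ∧ o ≤ 1) ∨ (3 ≤ j ∧ j < 3 + B ∧ o = h (j - 3)) := by
  have h1 : (j * M + o) / M = j := by
    rw [mul_comm, Nat.mul_add_div (by omega), Nat.div_eq_of_lt ho, add_zero]
  have h2 : (j * M + o) % M = o := by
    rw [mul_comm, Nat.mul_add_mod, Nat.mod_eq_of_lt ho]
  simp only [hardBit, h1, h2, decide_eq_true_eq]

/-- The letters of a hard word. -/
def hardWord (M B : ℕ) (h : ℕ → ℕ) (p : ℕ) : Letter :=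
  letterOf (hardBit M B h (p - 2)) (hardBit M B h (p - 1)) (hardBit M B h p)

lemma letterOf_false (a c : Bool) : letterOf a false c = .zero := by
  cases a <;> cases c <;> rfl

/-- A hash is read at the second bit of `11` and a one at the last bit of `010`, one place after the
set bit; hence the shift by one in `3 * M + 1`. The bounds on `h` keep the two patterns from
touching. -/
lemma hardRun_of_step {q : ℕ → State M} (h3 : ∀ i < B, 3 ≤ h i) (hM : ∀ i < B, h i + 2 ≤ M)
    (hM2 : 3 ≤ M) (hh : ∀ j < B, ∀ i < j, h i = h j → ∃ l, i < l ∧ l < j ∧ h i < h l)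
    (hq : ∀ p, 1 ≤ p → p < (3 + B) * M + 1 + 2 * M →
      step (hardWord M B h (p + 1)) (q p) (q (p + 1))) :
    HardRun M B (3 * M + 1) (fun i => h i) (hardWord M B h) q := by
  have hb : ∀ j o, o < M → ¬ ((3 ≤ j ∧ j ≤ 3 + B ∧ o ≤ 1) ∨
      (3 ≤ j ∧ j < 3 + B ∧ o = h (j - 3))) → hardBit M B h (j * M + o) = false := fun j o ho hn =>
    Bool.eq_false_iff.mpr fun ht => hn ((hardBit_iff ho).mp ht)
  have hb' : ∀ j o, o < M → ((3 ≤ j ∧ j ≤ 3 + B ∧ o ≤ 1) ∨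
      (3 ≤ j ∧ j < 3 + B ∧ o = h (j - 3))) → hardBit M B h (j * M + o) = true := fun j o ho hn =>
    (hardBit_iff ho).mpr hn
  have hpos : ∀ i o, 3 * M + 1 + i * M + o = (3 + i) * M + (o + 1) := fun i o => by ring
  have hdm : ∀ p, ∃ j o, o < M ∧ p = j * M + o := fun p =>
    ⟨p / M, p % M, Nat.mod_lt _ (by omega), by rw [mul_comm]; exact (Nat.div_add_mod p M).symm⟩
  have hmul : ∀ {a b : ℕ}, a ≤ b → a * M ≤ b * M := fun hab => Nat.mul_le_mul_right M hab
  refine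
    { step := fun p h1 h2 => hq p (by omega) (by rw [add_mul]; omega)
      pos := by omega
      before := fun p h1 h2 => ?_
      after := fun p h1 h2 => ?_
      hash := fun i hi => ?_
      height_pos := fun i hi => by have := h3 i hi; omega
      height_lt := fun i hi => by have := hM i hi; omega
      one := fun i hi => ?_
      zero := fun i hi o o0 oM hoh => ?_
      higher := hh }
  · rw [hardWord]
    obtain ⟨j, o, ho, hj⟩ := hdm (p - 1)
    have hj3 : j < 3 := by
      by_contra! hn
      have := hmul hn
      omega
    rw [hj, hb j o ho (by omega), letterOf_false]
  · rw [hardWord]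
    obtain ⟨j, o, ho, hj⟩ := hdm (p - 1)
    have hjB : 3 + B ≤ j := by
      by_contra! hn
      have := hmul (show j + 1 ≤ 3 + B by omega)
      rw [add_mul, add_mul] at this
      omega
    by_cases hc : j = 3 + B ∧ o ≤ 1
    · obtain ⟨rfl, ho1⟩ := hc
      have e := add_mul 3 B M
      obtain rfl : o = 1 := by omega
      rw [show p - 2 = (3 + B) * M + 0 by omega, hj, show p = (3 + B) * M + 2 by omega,
        hb' _ 0 (by omega) (by omega), hb' _ 1 (by omega) (by omega),
        hb _ 2 (by omega) (by omega)]
      rfl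
    · rw [hj, hb j o ho (by omega), letterOf_false]
  · rw [hardWord, ← add_zero (_ + i * M), hpos, show (3 + i) * M + (0 + 1) - 1 = (3 + i) * M + 0
      by omega, hb' _ 0 (by omega) (by omega), hb' _ (0 + 1) (by omega) (by omega)]
    cases hardBit M B h ((3 + i) * M + (0 + 1) - 2) <;> rfl
  · have a := h3 i hi
    have b := hM i hi
    have e : 3 + i - 3 = i := by omega
    rw [hardWord, hpos, show (3 + i) * M + (h i + 1) - 1 = (3 + i) * M + h i by omega,
      show (3 + i) * M + (h i + 1) - 2 = (3 + i) * M + (h i - 1) by omega,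
      hb _ (h i - 1) (by omega) (by rw [e]; omega), hb' _ (h i) (by omega) (by rw [e]; omega),
      hb _ (h i + 1) (by omega) (by rw [e]; omega)]
    rfl
  · have a := h3 i hi
    have e : 3 + i - 3 = i := by omega
    rw [hardWord, hpos, show (3 + i) * M + (o + 1) - 1 = (3 + i) * M + o by omega]
    obtain rfl | o1 : o = 1 ∨ 1 < o := by omega
    · rw [show (3 + i) * M + (1 + 1) - 2 = (3 + i) * M + 0 by omega,
        hb' _ 0 (by omega) (by omega), hb' _ 1 (by omega) (by omega),
        hb _ (1 + 1) (by omega) (by rw [e]; omega)]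
      rfl
    · rw [hb _ o (by omega) (by rw [e]; omega), letterOf_false]

end HardWord

/-! ### Ruler heights and the inserted block. -/

section Heights

/-- Write the numbers as `2 ^ v` times odd `x < y`; then `2 ^ v * (x + 1)` lies strictly between. -/
lemma exists_higher_padicValNat {a b : ℕ} (ha : 0 < a) (hab : a < b)
    (h : padicValNat 2 a = padicValNat 2 b) :
    ∃ c, a < c ∧ c < b ∧ padicValNat 2 a < padicValNat 2 c := by
  set v := padicValNat 2 a with hv
  obtain ⟨x, hx⟩ : 2 ^ v ∣ a := pow_padicValNat_dvd
  obtain ⟨y, hy⟩ : 2 ^ v ∣ b := h ▸ pow_padicValNat_dvd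
  have hp : 0 < 2 ^ v := by positivity
  have hx1 : x % 2 = 1 := by
    by_contra hn
    have : 2 ^ (v + 1) ∣ a := by
      rw [hx, pow_succ]; exact mul_dvd_mul_left _ (by omega)
    have := (padicValNat_dvd_iff_le (p := 2) (by omega)).mp this
    omega
  have hy1 : y % 2 = 1 := by
    by_contra hn
    have : 2 ^ (v + 1) ∣ b := by
      rw [hy, pow_succ]; exact mul_dvd_mul_left _ (by omega)
    have := (padicValNat_dvd_iff_le (p := 2) (by omega)).mp this
    omega
  have hxy : x < y := by
    by_contra! hn
    have := Nat.mul_le_mul_left (2 ^ v) hn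
    omega
  refine ⟨2 ^ v * (x + 1), ?_, ?_, ?_⟩
  · rw [hx]; exact Nat.mul_lt_mul_of_pos_left (by omega) hp
  · rw [hy]; exact Nat.mul_lt_mul_of_pos_left (by omega) hp
  · refine (padicValNat_dvd_iff_le (p := 2) (by positivity)).mp ?_
    rw [pow_succ]; exact mul_dvd_mul_left _ (by omega)

lemma padicValNat_two_lt {a k : ℕ} (ha : 0 < a) (h : a < 2 ^ k) : padicValNat 2 a < k := by
  have := Nat.le_of_dvd ha (pow_padicValNat_dvd (p := 2) (n := a))
  exact (Nat.pow_lt_pow_iff_right one_lt_two).mp (this.trans_lt h)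

/-- The heights of the ruler word. -/
def rulerHeight (i : ℕ) : ℕ := padicValNat 2 (i + 1) + 3

/-- The heights of the ruler word with a block of height `k + 4` inserted at `2 ^ k`. -/
def insertedHeight (k i : ℕ) : ℕ :=
  if i < 2 ^ k then rulerHeight i else if i = 2 ^ k then k + 4 else rulerHeight (i - 1)

lemma rulerHeight_le {k i : ℕ} (h : i + 1 < 2 ^ (k + 1)) : rulerHeight i ≤ k + 3 := by
  have := padicValNat_two_lt (Nat.succ_pos i) h
  simp only [rulerHeight, Nat.succ_eq_add_one] at *
  omega

lemma rulerHeight_higher (j i : ℕ) (hij : i < j) (h : rulerHeight i = rulerHeight j) :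
    ∃ l, i < l ∧ l < j ∧ rulerHeight i < rulerHeight l := by
  obtain ⟨c, h1, h2, h3⟩ := exists_higher_padicValNat (a := i + 1) (b := j + 1) (by omega)
    (by omega) (by simpa [rulerHeight] using h)
  exact ⟨c - 1, by omega, by omega, by
    simp only [rulerHeight, show c - 1 + 1 = c by omega]; omega⟩

lemma insertedHeight_le {k i : ℕ} (h : i < 2 ^ (k + 1)) : insertedHeight k i ≤ k + 4 := by
  have hk : 2 ^ (k + 1) = 2 * 2 ^ k := by ring
  have hp : 0 < 2 ^ k := by positivity
  unfold insertedHeight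
  split_ifs
  · have := rulerHeight_le (k := k) (i := i) (by omega); omega
  · omega
  · have := rulerHeight_le (k := k) (i := i - 1) (by omega); omega

lemma three_le_insertedHeight (k i : ℕ) : 3 ≤ insertedHeight k i := by
  unfold insertedHeight rulerHeight
  split_ifs <;> omega

lemma insertedHeight_of_lt {k i : ℕ} (h : i < 2 ^ k) : insertedHeight k i = rulerHeight i :=
  if_pos h

lemma insertedHeight_of_gt {k i : ℕ} (h : 2 ^ k < i) :
    insertedHeight k i = rulerHeight (i - 1) := by
  rw [insertedHeight, if_neg (by omega), if_neg (by omega)]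

lemma insertedHeight_self (k : ℕ) : insertedHeight k (2 ^ k) = k + 4 := by
  simp [insertedHeight]

lemma insertedHeight_higher {k : ℕ} (j : ℕ) (hj : j < 2 ^ (k + 1)) (i : ℕ) (hij : i < j)
    (h : insertedHeight k i = insertedHeight k j) :
    ∃ l, i < l ∧ l < j ∧ insertedHeight k i < insertedHeight k l := by
  have hk : 2 ^ (k + 1) = 2 * 2 ^ k := by ring
  rcases lt_trichotomy j (2 ^ k) with hj' | rfl | hj'
  · rw [insertedHeight_of_lt hj', insertedHeight_of_lt (hij.trans hj')] at h
    obtain ⟨l, h1, h2, h3⟩ := rulerHeight_higher j i hij h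
    refine ⟨l, h1, h2, ?_⟩
    rwa [insertedHeight_of_lt (by omega), insertedHeight_of_lt (by omega)]
  · rw [insertedHeight_of_lt hij, insertedHeight_self] at h
    have := rulerHeight_le (k := k) (i := i) (by omega)
    omega
  · rw [insertedHeight_of_gt hj'] at h
    have hj3 := rulerHeight_le (k := k) (i := j - 1) (by omega)
    rcases lt_trichotomy i (2 ^ k) with hi' | rfl | hi'
    · refine ⟨2 ^ k, hi', hj', ?_⟩
      rw [h, insertedHeight_self]
      omega
    · rw [insertedHeight_self] at h
      omega
    · rw [insertedHeight_of_gt hi'] at h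
      obtain ⟨l, h1, h2, h3⟩ := rulerHeight_higher (j - 1) (i - 1) (by omega) h
      refine ⟨l + 1, by omega, by omega, ?_⟩
      rwa [insertedHeight_of_gt hi', insertedHeight_of_gt (by omega), Nat.add_sub_cancel]

end Heights

/-! ### Comparing the two hard instances. -/

lemma hardBit_inserted_of_lt {M k p : ℕ} (hM : 0 < M) (hp : p < (3 + 2 ^ k) * M) :
    hardBit M (2 ^ (k + 1)) (insertedHeight k) p =
      hardBit M (2 ^ (k + 1) - 1) rulerHeight p := by
  have hk : 2 ^ (k + 1) = 2 * 2 ^ k := by ring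
  have hpos : 0 < 2 ^ k := by positivity
  have hj : p / M < 3 + 2 ^ k := (Nat.div_lt_iff_lt_mul hM).mpr hp
  unfold hardBit
  congr 1
  apply propext
  by_cases h3 : 3 ≤ p / M
  · rw [insertedHeight_of_lt (by omega)]
    omega
  · omega

lemma hardBit_inserted_of_ge {M k p : ℕ} (hM : 0 < M) (hp : (3 + 2 ^ k) * M ≤ p) :
    hardBit M (2 ^ (k + 1)) (insertedHeight k) (p + M) =
      hardBit M (2 ^ (k + 1) - 1) rulerHeight p := by
  have hk : 2 ^ (k + 1) = 2 * 2 ^ k := by ring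
  have hpos : 0 < 2 ^ k := by positivity
  have hj : 3 + 2 ^ k ≤ p / M := (Nat.le_div_iff_mul_le hM).mpr hp
  unfold hardBit
  rw [Nat.add_div_right _ hM, Nat.add_mod_right]
  congr 1
  apply propext
  rw [insertedHeight_of_gt (by omega), show (p / M).succ - 3 - 1 = p / M - 3 by omega]
  omega

theorem run_alternates {M β n B k : ℕ} (e : Label M ↪ Fin β) {A : LocalAlgorithm β}
    (hA : A.Solves (problem e) k) {h : ℕ → ℕ} (h3 : ∀ i < B, 3 ≤ h i)
    (hM : ∀ i < B, h i + 2 ≤ M) (hM2 : 3 ≤ M)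
    (hh : ∀ j < B, ∀ i < j, h i = h j → ∃ l, i < l ∧ l < j ∧ h i < h l)
    (hn : (3 + B) * M + 2 + 2 * M ≤ n) (I : Instance n) (hI : I.IdentBounded k)
    (hin : ∀ v, I.input v = hardBit M B h v) :
    ∃ c, ∀ (d : ℕ) (v : Fin n), d < B * M → (v : ℕ) = 3 * M + 1 + d →
      ∃ b, A.run I v = e (b, .color (xor c d.bodd)) := by
  obtain ⟨h1, h2⟩ := hA n I hI
  simp only [problem, Finset.mem_filter, Finset.mem_univ, true_and] at h1 h2
  choose lab hlab hbit using h1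
  have h2' : ∀ u v : Fin n, (u : ℕ) + 1 = v → (lab v).1.1 = (lab u).1.2.1 ∧
      (lab v).1.2.1 = (lab u).1.2.2 ∧
      step (letterOf (lab v).1.1 (lab v).1.2.1 (lab v).1.2.2) (lab u).2 (lab v).2 := by
    intro u v huv
    obtain ⟨l, l', a, b, c⟩ := h2 u v huv
    rw [← hlab, e.apply_eq_iff_eq] at a b
    rwa [a, b] at c
  let q : ℕ → State M := fun p => if hp : p < n then (lab ⟨p, hp⟩).2 else .start
  -- The first two nodes may lie about the bits before them; from node `2` on, the claimed bits are
  -- forced.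
  have hstep : ∀ p, 1 ≤ p → p + 1 < n → step (hardWord M B h (p + 1)) (q p) (q (p + 1)) := by
    intro p hp1 hpn
    obtain ⟨a1, a2, a3⟩ := h2' ⟨p, by omega⟩ ⟨p + 1, hpn⟩ rfl
    obtain ⟨-, b2, -⟩ := h2' ⟨p - 1, by omega⟩ ⟨p, by omega⟩ (by simp; omega)
    rw [a1, b2, a2, hbit, hbit, hbit, hin, hin, hin] at a3
    simp only [q, dif_pos hpn, dif_pos (show p < n by omega)]
    exact a3
  have H := hardRun_of_step h3 hM hM2 hh (q := q) fun p hp hpn => hstep p hp (by omega)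
  obtain ⟨c, hc⟩ := H.alternates (by omega)
  refine ⟨c, fun d v hd hv => ⟨(lab v).1, ?_⟩⟩
  have := hc d hd
  rw [← hv] at this
  simp only [q, dif_pos v.2] at this
  rw [← hlab, ← this]

lemma Instance.view_eq {n T : ℕ} {I I' : Instance n} {v v' : Fin n}
    (hr : ∀ d : ℤ, |d| ≤ T → (0 ≤ (v : ℤ) + d ∧ (v : ℤ) + d < n ↔
      0 ≤ (v' : ℤ) + d ∧ (v' : ℤ) + d < n))
    (h : ∀ u u' : Fin n, |(u : ℤ) - v| ≤ T → (u : ℤ) - v = u' - v' →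
      I.input u = I'.input u' ∧ I.ident u = I'.ident u') : I.view T v = I'.view T v' := by
  funext d
  by_cases hd : |d| ≤ T ∧ 0 ≤ (v : ℤ) + d ∧ (v : ℤ) + d < n
  · have hd' : |d| ≤ T ∧ 0 ≤ (v' : ℤ) + d ∧ (v' : ℤ) + d < n := ⟨hd.1, (hr d hd.1).mp hd.2⟩
    have e : ((v : ℤ) + d).toNat - (v : ℤ) = d := by omega
    have e' : ((v' : ℤ) + d).toNat - (v' : ℤ) = d := by omega
    obtain ⟨a, b⟩ := h ⟨((v : ℤ) + d).toNat, by omega⟩ ⟨((v' : ℤ) + d).toNat, by omega⟩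
      (by simpa only [e] using hd.1) (by simp only [e, e'])
    simp only [Instance.view, dif_pos hd, dif_pos hd', a, b]
  · have hd' : ¬ (|d| ≤ T ∧ 0 ≤ (v' : ℤ) + d ∧ (v' : ℤ) + d < n) := fun hd' =>
      hd ⟨hd'.1, (hr d hd'.1).mpr hd'.2⟩
    simp only [Instance.view, dif_neg hd, dif_neg hd']

theorem two_pow_le_rounds {M β k κ : ℕ} (hMk : M = k + 6) (hodd : M.bodd = true)
    (hκ : 1 ≤ κ) (e : Label M ↪ Fin β) {A : LocalAlgorithm β} (hA : A.Solves (problem e) κ)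
    {n : ℕ} (hn : (7 + 2 ^ (k + 2)) * M ≤ n) : 2 ^ k ≤ A.rounds n := by
  by_contra! hT
  set T := A.rounds n with hTdef
  have hk1 : 2 ^ (k + 1) = 2 * 2 ^ k := by ring
  have hk2 : 2 ^ (k + 2) = 4 * 2 ^ k := by ring
  have hpos : 0 < 2 ^ k := by positivity
  set P := (3 + 2 ^ k) * M with hP
  have hKM : 6 * 2 ^ k ≤ 2 ^ k * M := by rw [mul_comm]; exact Nat.mul_le_mul_left _ (by omega)
  have hKM' : 2 ^ k + M ≤ 2 ^ k * M + 1 := by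
    obtain ⟨a, ha⟩ := Nat.exists_eq_add_of_lt hpos
    rw [ha, hMk]
    nlinarith
  have eP : P = 3 * M + 2 ^ k * M := by rw [hP]; ring
  have en : (7 + 2 ^ (k + 2)) * M = 7 * M + 4 * (2 ^ k * M) := by rw [hk2]; ring
  have eB : 2 ^ (k + 1) * M = 2 * (2 ^ k * M) := by rw [hk1]; ring
  have eB1 : (2 ^ (k + 1) - 1) * M + M = 2 * (2 ^ k * M) := by
    rw [← eB, Nat.sub_mul, one_mul]
    exact Nat.sub_add_cancel (Nat.le_mul_of_pos_left M (by positivity))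
  have hpow : n ≤ n ^ κ := Nat.le_self_pow (by omega) n
  set I₁ : Instance n := ⟨fun v => hardBit M (2 ^ (k + 1) - 1) rulerHeight v, fun v => v + 1,
    fun u v huv => by ext; simpa using huv⟩ with hI₁
  -- The inserted block takes the identifiers of the last `M` nodes of `I₁`, which are pushed off
  -- the path; all other nodes keep theirs.
  set I₂ : Instance n := ⟨fun v => hardBit M (2 ^ (k + 1)) (insertedHeight k) v,
    fun v => if (v : ℕ) < P then v + 1 else if (v : ℕ) < P + M then n - M + (v - P) + 1
      else v - M + 1, fun u v huv => by
        have := u.2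
        have := v.2
        ext
        simp only at huv
        split_ifs at huv <;> omega⟩ with hI₂
  have hb₁ : I₁.IdentBounded κ := fun v => by
    have := v.2
    simp only [hI₁]; omega
  have hb₂ : I₂.IdentBounded κ := fun v => by
    have := v.2
    simp only [hI₂]; split_ifs <;> omega
  have e3 := add_mul 3 (2 ^ (k + 1) - 1) M
  have e3' := add_mul 3 (2 ^ (k + 1)) M
  obtain ⟨c₁, h₁⟩ := run_alternates e hA (h := rulerHeight) (B := 2 ^ (k + 1) - 1)
    (fun i _ => Nat.le_add_left _ _)
    (fun i hi => by have := rulerHeight_le (k := k) (i := i) (by omega); omega) (by omega)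
    (fun j _ => rulerHeight_higher j) (by omega) I₁ hb₁ fun _ => rfl
  obtain ⟨c₂, h₂⟩ := run_alternates e hA (h := insertedHeight k) (B := 2 ^ (k + 1))
    (fun i _ => three_le_insertedHeight k i)
    (fun i hi => by have := insertedHeight_le hi; omega) (by omega)
    insertedHeight_higher (by omega) I₂ hb₂ fun _ => rfl
  have v₁ : I₁.view T ⟨3 * M + 1, by omega⟩ = I₂.view T ⟨3 * M + 1, by omega⟩ := by
    refine Instance.view_eq (fun _ _ => Iff.rfl) fun u u' hu huu => ?_
    obtain rfl : u = u' := by ext; simpa using huu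
    have hlt : (u : ℕ) < P := by rw [abs_le] at hu; simp only at hu; omega
    exact ⟨(hardBit_inserted_of_lt (by omega) hlt).symm, (if_pos hlt).symm⟩
  have v₂ : I₁.view T ⟨P + T, by omega⟩ = I₂.view T ⟨P + T + M, by omega⟩ := by
    refine Instance.view_eq (fun d hd => ?_) fun u u' hu huu => ?_
    · rw [abs_le] at hd; simp only; push_cast; omega
    · simp only at hu huu
      rw [abs_le] at hu
      have hge : P ≤ (u : ℕ) := by omega
      have huM : (u' : ℕ) = u + M := by omega
      refine ⟨?_, ?_⟩
      · simp only [hI₁, hI₂, huM]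
        exact (hardBit_inserted_of_ge (by omega) hge).symm
      · simp only [hI₁, hI₂, huM]
        rw [if_neg (by omega), if_neg (by omega), Nat.add_sub_cancel]
  obtain ⟨_, a₁⟩ := h₁ 0 ⟨3 * M + 1, by omega⟩ (by omega) rfl
  obtain ⟨_, a₂⟩ := h₂ 0 ⟨3 * M + 1, by omega⟩ (by omega) rfl
  obtain ⟨_, b₁⟩ := h₁ (P + T - (3 * M + 1)) ⟨P + T, by omega⟩ (by omega) (by simp only; omega)
  obtain ⟨_, b₂⟩ := h₂ (P + T - (3 * M + 1) + M) ⟨P + T + M, by omega⟩ (by omega)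
    (by simp only; omega)
  have ha := congrArg (A.decide n) v₁
  have hb := congrArg (A.decide n) v₂
  change A.run I₁ _ = A.run I₂ _ at ha hb
  rw [a₁, a₂, e.apply_eq_iff_eq, Prod.mk.injEq] at ha
  rw [b₁, b₂, e.apply_eq_iff_eq, Prod.mk.injEq] at hb
  have ha := State.color.inj ha.2
  have hb := State.color.inj hb.2
  -- The left nodes force `c₁ = c₂`, while the odd shift `M` on the right forces `c₁ ≠ c₂`.
  rw [Nat.bodd_add, hodd] at hb
  revert ha hb
  cases c₁ <;> cases c₂ <;> cases (P + T - (3 * M + 1)).bodd <;> simp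

end PathLCL

/-! ### Choice of parameters. -/

theorem mainTheorem5 :
    ∃ c : ℝ, 0 < c ∧ ∃ β₀ : ℕ, ∀ β : ℕ, β₀ ≤ β → ∃ P : PathLCL.NormalizedLCL β,
      (∃ t : ℕ, ∀ k : ℕ, 1 ≤ k →
        ∃ A : PathLCL.LocalAlgorithm β, A.Solves P k ∧ ∀ n : ℕ, A.rounds n ≤ t) ∧
      (∃ N : ℕ, ∀ k : ℕ, 1 ≤ k →
        ∀ A : PathLCL.LocalAlgorithm β, A.Solves P k →
          ∀ n : ℕ, N ≤ n → (2 : ℝ) ^ (c * (β : ℝ)) ≤ (A.rounds n : ℝ)) := by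
  refine ⟨1 / 100, by norm_num, 248, fun β hβ => ?_⟩
  -- With the odd block length `M = 2 * m + 7`, the label bound `24 * M + 32` is `48 * m + 200`. The
  -- threshold `248` gives `m ≥ 1`, whence `β / 100 ≤ 2 * m + 1`.
  obtain ⟨m, hm, hm'⟩ : ∃ m, 48 * m + 200 ≤ β ∧ β < 48 * (m + 1) + 200 :=
    ⟨(β - 200) / 48, by omega, by omega⟩
  let e : PathLCL.Label (2 * m + 7) ↪ Fin β :=
    ⟨fun l => ⟨PathLCL.Label.code l, by have := PathLCL.Label.code_lt l; omega⟩,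
      fun _ _ h => PathLCL.Label.code_injective (Fin.mk.inj h)⟩
  refine ⟨PathLCL.problem e, ?_, (7 + 2 ^ (2 * m + 1 + 2)) * (2 * m + 7), ?_⟩
  · obtain ⟨t, ht⟩ := PathLCL.exists_constant_algorithm (by omega) e
    exact ⟨t, fun k _ => ht k⟩
  · intro k hk A hA n hn
    have h := PathLCL.two_pow_le_rounds (k := 2 * m + 1) (by omega) (by simp)
      hk e hA hn
    calc (2 : ℝ) ^ (1 / 100 * (β : ℝ)) ≤ (2 : ℝ) ^ ((2 * m + 1 : ℕ) : ℝ) := by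
          refine Real.rpow_le_rpow_of_exponent_le one_le_two ?_
          have h1 : (β : ℝ) < 48 * (m + 1) + 200 := by exact_mod_cast hm'
          have h2 : (1 : ℝ) ≤ m := by exact_mod_cast (by omega : 1 ≤ m)
          push_cast
          linarith
      _ = ((2 ^ (2 * m + 1) : ℕ) : ℝ) := by rw [Real.rpow_natCast]; push_cast; rfl
      _ ≤ A.rounds n := by exact_mod_cast h
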